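/- Let $G$ be a Lie group with Lie algebra $\mathfrak g$, let $\pi:P\to M$ be a smooth principal $G$-bundle (with $G$ acting on $P$ on the right, all manifolds finite-dimensional and without boundary), and let $k$ be an $\mathrm{Ad}$-invariant inner product on $\mathfrak g$. A bundle metric on $P$ is a Riemannian metric of the form $h=\pi^*g+k\omega$, where $g$ is a Riemannian metric on $M$, $\omega$ is a principal connection 1-form on $P$ and $(k\omega)(U,V)=k(\omega(U),\omega(V))$. For such $h$ let $Rc(h)$ be its Ricci tensor, let $p_h$ be the $h$-orthogonal projection of $TP$ onto the vertical bundle $\ker d\pi$, and put $Rc^V(h)(U,V)=Rc(h)(p_h(U),p_h(V))$. A solution of the Ricci Yang-Mills flow on a time interval $J\subset\mathbb R$ is a smooth family $(h_t)_{t\in J}$ of bundle metrics (with $k$ fixed) satisfying $$\frac{\partial h}{\partial t}=-2\,(Rc(h)-Rc^V(h)).$$ Theorem. Let $F:P\to P$ be an automorphism of the principal bundle, that is, a diffeomorphism with $F(pa)=F(p)a$ for all $p\in P$, $a\in G$. Then the Ricci Yang-Mills flow is invariant under $F$: a family $(h_t)_{t\in J}$ of covariant 2-tensor fields on $P$ is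 a solution of the Ricci Yang-Mills flow if and only if $(F^*h_t)_{t\in J}$ is. Moreover, for every bundle metric $h$ on $P$, the pullback $F^*h$ is again a bundle metric (with the same $k$), and $Rc^V(F^*h)=F^*Rc^V(h)$. -/

import Mathlib

open scoped Manifold ContDiff Bundle

set_option maxSynthPendingDepth 3

noncomputable section

/-! ### Curvature of a metric on (an open set of) a finite-dimensional vector space -/

section Coordinates

variable {E : Type*} [NormedAddCommGroup E] [NormedSpace ℝ E]

/-- Twice the Christoffel symbols of the first kind of the metric `G` at `y`:
`(u, v, w) ↦ ∂_u G(v, w) + ∂_v G(u, w) - ∂_w G(u, v)`. -/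
def koszulForm (G : E → E →L[ℝ] E →L[ℝ] ℝ) (y : E) : E →L[ℝ] E →L[ℝ] E →L[ℝ] ℝ :=
  fderiv ℝ G y + (fderiv ℝ G y).flip
    - (ContinuousLinearMap.flipₗᵢ ℝ E E ℝ).toContinuousLinearEquiv.toContinuousLinearMap ∘L
        (fderiv ℝ G y).flip

theorem koszulForm_apply (G : E → E →L[ℝ] E →L[ℝ] ℝ) (y u v w : E) :
    koszulForm G y u v w =
      fderiv ℝ G y u v w + fderiv ℝ G y v u w - fderiv ℝ G y w u v := rfl

/-- The Christoffel symbols (of the second kind) of the metric `G` at `y`: the Levi-Civita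
connection of `G` is `∇_u V = ∂_u V + Γ(u, V)`.  The factor `(G y).inverse` raises the index. -/
def christoffel (G : E → E →L[ℝ] E →L[ℝ] ℝ) (y : E) : E →L[ℝ] E →L[ℝ] E :=
  (1 / 2 : ℝ) • (ContinuousLinearMap.compL ℝ E (E →L[ℝ] ℝ) E (G y).inverse ∘L koszulForm G y)

theorem christoffel_apply (G : E → E →L[ℝ] E →L[ℝ] ℝ) (y u v : E) :
    christoffel G y u v = (1 / 2 : ℝ) • (G y).inverse (koszulForm G y u v) := rfl

/-- The curvature `R(u, v) w` of the metric `G` at `y`, as a linear map in `u`. -/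
def coordCurvature (G : E → E →L[ℝ] E →L[ℝ] ℝ) (y v w : E) : E →ₗ[ℝ] E where
  toFun u := fderiv ℝ (christoffel G) y u v w - fderiv ℝ (christoffel G) y v u w
    + christoffel G y u (christoffel G y v w) - christoffel G y v (christoffel G y u w)
  map_add' u₁ u₂ := by
    simp only [map_add, add_apply]; abel
  map_smul' c u := by
    simp only [map_smul, smul_apply, RingHom.id_apply, smul_add, smul_sub]

/-- The Ricci curvature of the metric `G` at `y`: `Rc(v, w) = tr (u ↦ R(u, v) w)`. -/
def coordRicci (G : E → E →L[ℝ] E →L[ℝ] ℝ) (y v w : E) : ℝ :=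
  LinearMap.trace ℝ E (coordCurvature G y v w)

end Coordinates

/-! ### Covariant 2-tensors on manifolds, pullback, Ricci tensor -/

section Tensors

variable {E : Type*} [NormedAddCommGroup E] [NormedSpace ℝ E]
  {H : Type*} [TopologicalSpace H] (I : ModelWithCorners ℝ E H)
  {E' : Type*} [NormedAddCommGroup E'] [NormedSpace ℝ E']
  {H' : Type*} [TopologicalSpace H'] (I' : ModelWithCorners ℝ E' H')
  {N : Type*} [TopologicalSpace N] [ChartedSpace H N]
  {N' : Type*} [TopologicalSpace N'] [ChartedSpace H' N']

variable (N) in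
/-- Covariant 2-tensor fields, not assumed to be smooth. -/
abbrev TwoTensor : Type _ := ∀ p : N, LinearMap.BilinForm ℝ (TangentSpace I p)

variable {I'} in
/-- The pullback `(F^* h)_p(u, v) = h_{F p}(dF u, dF v)`. -/
def TwoTensor.pullback (F : N → N') (h : TwoTensor I' N') : TwoTensor I N := fun p =>
  (h (F p)).comp (mfderiv I I' F p).toLinearMap (mfderiv I I' F p).toLinearMap

variable {I} in
/-- The expression of the tensor `h` in the preferred chart at `p`, as a matrix-valued function
on the model space `E` (it is meaningful on the target of the chart). -/
def TwoTensor.inChart [FiniteDimensional ℝ E] (h : TwoTensor I N) (p : N) :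
    E → E →L[ℝ] E →L[ℝ] ℝ := fun y =>
  LinearMap.toContinuousBilinearMap
    (TwoTensor.pullback 𝓘(ℝ, E) (extChartAt I p).symm h y : E →ₗ[ℝ] E →ₗ[ℝ] ℝ)

variable {I} in
/-- The Ricci tensor of a (smooth, nondegenerate) metric tensor `h` on a manifold without
boundary, computed at `p` in the preferred chart at `p`. -/
def ricci [FiniteDimensional ℝ E] (h : TwoTensor I N) (p : N) (u v : TangentSpace I p) : ℝ :=
  coordRicci (h.inChart p) (extChartAt I p p)
    (mfderiv I 𝓘(ℝ, E) (extChartAt I p) p u) (mfderiv I 𝓘(ℝ, E) (extChartAt I p) p v)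

end Tensors

/-! ### Principal bundles, connections, bundle metrics -/

section PrincipalBundles

variable {EM : Type*} [NormedAddCommGroup EM] [NormedSpace ℝ EM]
  {HM : Type*} [TopologicalSpace HM] (IM : ModelWithCorners ℝ EM HM)
  {EG : Type*} [NormedAddCommGroup EG] [NormedSpace ℝ EG]
  {HG : Type*} [TopologicalSpace HG] (IG : ModelWithCorners ℝ EG HG)
  {EP : Type*} [NormedAddCommGroup EP] [NormedSpace ℝ EP]
  {HP : Type*} [TopologicalSpace HP] (IP : ModelWithCorners ℝ EP HP)
  {M : Type*} [TopologicalSpace M] [ChartedSpace HM M]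
  {G : Type*} [TopologicalSpace G] [ChartedSpace HG G] [Group G]
  {P : Type*} [TopologicalSpace P] [ChartedSpace HP P] [MulAction Gᵐᵒᵖ P]

/-- `proj : P → M` is a smooth principal `G`-bundle, for the right action `p · g = op g • p` of `G`
on `P` (a right action of `G` is a left action of the opposite group). -/
structure IsPrincipalBundle (proj : P → M) : Prop where
  contMDiff_proj : ContMDiff IP IM ∞ proj
  contMDiff_action : ContMDiff (IP.prod IG) IP ∞ (fun x : P × G => MulOpposite.op x.2 • x.1)
  proj_action : ∀ (p : P) (g : G), proj (MulOpposite.op g • p) = proj p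
  /-- There are smooth equivariant local trivializations `π⁻¹(U) ≃ U × G`. -/
  exists_trivialization : ∀ x : M, ∃ e : Bundle.Trivialization G proj, x ∈ e.baseSet ∧
    ContMDiffOn IP (IM.prod IG) ∞ e e.source ∧
    ContMDiffOn (IM.prod IG) IP ∞ e.toOpenPartialHomeomorph.symm e.target ∧
    ∀ p ∈ e.source, ∀ g : G, (e (MulOpposite.op g • p)).2 = (e p).2 * g

/-- The differential at `1` of `g ↦ p · g`, that is `z ↦ Z_p = d/dt|_{t=0} p · exp(t z)`. -/
def fundamentalVector (p : P) : GroupLieAlgebra IG G →L[ℝ] TangentSpace IP p :=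
  mfderiv IG IP (fun g : G => MulOpposite.op g • p) 1

/-- The adjoint action of `g` on the Lie algebra: the differential at `1` of `x ↦ g x g⁻¹`. -/
def adjointAction (g : G) : GroupLieAlgebra IG G →L[ℝ] GroupLieAlgebra IG G :=
  mfderiv IG IG (fun x : G => g * x * g⁻¹) 1

variable (G) in
/-- An `Ad`-invariant metric (inner product) on the Lie algebra of `G`. -/
structure AdInvariantMetric where
  inner : LinearMap.BilinForm ℝ (GroupLieAlgebra IG G)
  symm : ∀ y z, inner y z = inner z y
  pos : ∀ z, z ≠ 0 → 0 < inner z z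
  ad_invariant : ∀ (g : G) (y z),
    inner (adjointAction IG g y) (adjointAction IG g z) = inner y z

variable (G P) in
/-- A principal connection, given by its connection 1-form. -/
structure ConnectionForm [IsManifold IP 1 P] where
  form : ∀ p : P, TangentSpace IP p →L[ℝ] GroupLieAlgebra IG G
  /-- Smoothness of the 1-form, seen as a fibrewise linear function on the tangent bundle. -/
  contMDiff_form : ContMDiff IP.tangent 𝓘(ℝ, EG) ∞
    (fun X : TangentBundle IP P => show EG from form X.proj X.snd)
  form_fundamentalVector : ∀ (p : P) (z : GroupLieAlgebra IG G),
    form p (fundamentalVector IG IP p z) = z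
  form_action : ∀ (p : P) (g : G) (u : TangentSpace IP p),
    form (MulOpposite.op g • p)
      (mfderiv IP IP (fun q : P => MulOpposite.op g • q) p u) =
        adjointAction IG g⁻¹ (form p u)

variable {IG IP} in
/-- `h` is a bundle metric with fibre metric `k`: `h = π^* g + k A` for some Riemannian metric
`g` on the base and some principal connection form `A`, where `(k A)(u, v) = k(A(u), A(v))`. -/
def IsBundleMetric [IsManifold IM 1 M] [IsManifold IP 1 P]
    (k : AdInvariantMetric IG G) (proj : P → M) (h : TwoTensor IP P) : Prop :=
  ∃ (g : Bundle.ContMDiffRiemannianMetric IM ∞ EM (fun x : M => TangentSpace IM x))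
    (A : ConnectionForm IG IP G P), ∀ (p : P) (u v : TangentSpace IP p),
      h p u v = g.inner (proj p) (mfderiv IP IM proj p u) (mfderiv IP IM proj p v)
        + k.inner (A.form p u) (A.form p v)

/-! ### The vertical part of the Ricci tensor and the flow -/

/-- The vertical space at `p`, the kernel of `dπ`. -/
def verticalSpace (proj : P → M) (p : P) : Submodule ℝ (TangentSpace IP p) :=
  LinearMap.ker (mfderiv IP IM proj p).toLinearMap

variable {IP} in
open Classical in
/-- The projection `p_h` of tangent vectors onto the vertical space, orthogonal with respect to
`h`: `p_h(u)` is the vertical vector `w` such that `u - w` is `h`-orthogonal to all vertical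
vectors. -/
def verticalProj (proj : P → M) (h : TwoTensor IP P) (p : P) (u : TangentSpace IP p) :
    TangentSpace IP p :=
  if H : ∃ w ∈ verticalSpace IM IP proj p, ∀ v ∈ verticalSpace IM IP proj p, h p (u - w) v = 0
  then H.choose else 0

variable {IP} in
/-- For a basis `Z_i` of the vertical space that is orthonormal for `h`, the projection is
`p_h(u) = ∑ i, h(Z_i, u) Z_i`. -/
theorem verticalProj_eq_sum (proj : P → M) (h : TwoTensor IP P) (p : P)
    (hsymm : ∀ u v, h p u v = h p v u) (hpos : ∀ u, u ≠ 0 → 0 < h p u u)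
    {ι : Type*} [Fintype ι] [DecidableEq ι] (Z : ι → TangentSpace IP p)
    (hspan : Submodule.span ℝ (Set.range Z) = verticalSpace IM IP proj p)
    (hZ : ∀ i j, h p (Z i) (Z j) = if i = j then 1 else 0) (u : TangentSpace IP p) :
    verticalProj IM proj h p u = ∑ i, h p (Z i) u • Z i := by
  set s := ∑ i, h p (Z i) u • Z i with hs
  have hmem : ∀ i, Z i ∈ verticalSpace IM IP proj p := fun i => by
    rw [← hspan]; exact Submodule.subset_span ⟨i, rfl⟩
  have hsV : s ∈ verticalSpace IM IP proj p :=
    Submodule.sum_mem _ fun i _ => Submodule.smul_mem _ _ (hmem i)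
  have horth : ∀ v ∈ verticalSpace IM IP proj p, h p (u - s) v = 0 := by
    intro v hv
    rw [← hspan] at hv
    induction hv using Submodule.span_induction with
    | mem x hx =>
      obtain ⟨j, rfl⟩ := hx
      simp [hs, hZ, hsymm u (Z j)]
    | zero => simp
    | add x y _ _ hx hy => rw [map_add, hx, hy, add_zero]
    | smul c x _ hx => rw [map_smul, hx, smul_zero]
  have H : ∃ w ∈ verticalSpace IM IP proj p, ∀ v ∈ verticalSpace IM IP proj p, h p (u - w) v = 0 :=
    ⟨s, hsV, horth⟩
  rw [verticalProj, dif_pos H]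
  obtain ⟨h1, h2⟩ := H.choose_spec
  by_contra hne
  have hd := hpos _ (sub_ne_zero.mpr hne)
  have hm := Submodule.sub_mem _ h1 hsV
  have e : H.choose - s = (u - s) - (u - H.choose) := by abel
  have : h p (H.choose - s) (H.choose - s) = 0 := by
    have e2 := LinearMap.BilinForm.sub_left (B₁ := h p) (u - s) (u - H.choose) (H.choose - s)
    rw [← e, horth _ hm, h2 _ hm, sub_zero] at e2
    exact e2
  exact hd.ne' this

variable {IP} in
/-- The vertical projection of the Ricci tensor, `Rc^V(h)(u, v) = Rc(h)(p_h(u), p_h(v))`. -/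
def ricciVertical [FiniteDimensional ℝ EP] (proj : P → M) (h : TwoTensor IP P) (p : P)
    (u v : TangentSpace IP p) : ℝ :=
  ricci h p (verticalProj IM proj h p u) (verticalProj IM proj h p v)

variable {IG IP} in
/-- `h` is a solution on the time interval `J` of the Ricci Yang-Mills flow with fibre metric
`k`: a smooth family of bundle metrics with `∂h/∂t = -2 (Rc(h) - Rc^V(h))` (with one-sided
derivatives at the end points of `J` that belong to `J`). -/
structure IsRicciYangMillsFlow [FiniteDimensional ℝ EP] [IsManifold IM 1 M] [IsManifold IP 1 P]
    (k : AdInvariantMetric IG G) (proj : P → M) (J : Set ℝ) (h : ℝ → TwoTensor IP P) : Prop where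
  isBundleMetric : ∀ t ∈ J, IsBundleMetric IM k proj (h t)
  /-- Joint smoothness in time and space, seen on the quadratic forms of the metrics. -/
  contMDiffOn : ContMDiffOn (𝓘(ℝ, ℝ).prod IP.tangent) 𝓘(ℝ, ℝ) ∞
    (fun x : ℝ × TangentBundle IP P => h x.1 x.2.proj x.2.snd x.2.snd) (J ×ˢ Set.univ)
  evolution : ∀ t ∈ J, ∀ (p : P) (u v : TangentSpace IP p),
    HasDerivWithinAt (fun s => h s p u v)
      (-2 * (ricci (h t) p u v - ricciVertical IM proj (h t) p u v)) J t

variable {IP} in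
/-- A diffeomorphism `F` of `P` is an automorphism of the principal bundle if it commutes with
the right action, `F(p · g) = F(p) · g`. -/
def IsBundleAutomorphism (G : Type*) [Group G] [MulAction Gᵐᵒᵖ P] (F : P ≃ₘ^∞⟮IP, IP⟯ P) :
    Prop :=
  ∀ (p : P) (g : G), F (MulOpposite.op g • p) = MulOpposite.op g • F p

end PrincipalBundles

end

/-!
All ingredients of the flow are natural under an automorphism `F` of the bundle, and `F⁻¹` is again
an automorphism, so it suffices to show that `F^*` carries solutions to solutions.

* *Bundle metrics.* The group acts transitively on the fibres of `π`, so `F` covers a map `f` of the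
  base. It is smooth because locally `f = π ∘ F ∘ σ` for a smooth section `σ`, and the map covered
  by `F⁻¹` is its inverse (`IsBundleAutomorphism.exists_baseDiffeo`). Since `f ∘ π = π ∘ F`,
  one gets `F^* (π^* g + k A) = π^* (f^* g) + k (F^* A)`, and `F^* A` is a connection form because
  `F` commutes with the action (`IsBundleMetric.pullback`).

* *Ricci tensor.* For `F` in charts, written `φ`, the Christoffel symbols obey
  `Dφ (Γ'(u, v)) = Γ(Dφ u, Dφ v) + D²φ(u, v)`. Differentiating this identity and antisymmetrizing
  shows that the curvature, hence its trace, is natural (`coordRicci_coordPullback`,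
  `ricci_pullback`). The computation needs smooth nondegenerate metrics. Bundle metrics are smooth,
  and they are positive definite because every vertical vector is the value of a fundamental vector
  field, on which the connection form is injective (`IsBundleMetric.contDiffAt_inChart`,
  `IsBundleMetric.pos`).

* *Vertical projection.* The differential of `F` maps vertical spaces onto vertical spaces, since
  that of `f` is injective. It is an isometry from `F^* h` to `h`, so it intertwines the orthogonal
  projections (`mfderiv_verticalProj_pullback`).
-/

noncomputable section

/-! ### Naturality of the Ricci tensor under changes of coordinates -/

section CoordinatePullback

open Filter Topology

variable {E : Type*} [NormedAddCommGroup E] [NormedSpace ℝ E]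
  {E' : Type*} [NormedAddCommGroup E'] [NormedSpace ℝ E']

/-- The pullback of a field of bilinear forms under a map between vector spaces. It is given by
`fderiv`, so it is meaningful where `φ` is differentiable. -/
def coordPullback (φ : E → E') (G : E' → E' →L[ℝ] E' →L[ℝ] ℝ) : E → E →L[ℝ] E →L[ℝ] ℝ :=
  fun y => (G (φ y)).bilinearComp (fderiv ℝ φ y) (fderiv ℝ φ y)

theorem coordPullback_apply (φ : E → E') (G : E' → E' →L[ℝ] E' →L[ℝ] ℝ) (y u v : E) :
    coordPullback φ G y u v = G (φ y) (fderiv ℝ φ y u) (fderiv ℝ φ y v) := rfl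

theorem ContDiffAt.coordPullback {φ : E → E'} {G : E' → E' →L[ℝ] E' →L[ℝ] ℝ} {y : E}
    {n m : WithTop ℕ∞} (hG : ContDiffAt ℝ n G (φ y)) (hφ : ContDiffAt ℝ m φ y) (hnm : n + 1 ≤ m) :
    ContDiffAt ℝ n (coordPullback φ G) y := by
  have hA : ContDiffAt ℝ n (fderiv ℝ φ) y := hφ.fderiv_right hnm
  have hGφ : ContDiffAt ℝ n (fun z => G (φ z)) y :=
    hG.comp y (hφ.of_le (le_trans le_self_add hnm))
  have key : ∀ B : E → E' →L[ℝ] E →L[ℝ] ℝ, ContDiffAt ℝ n B y →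
      ContDiffAt ℝ n (fun z => (B z).flip) y := fun B hB =>
    (ContinuousLinearMap.flipₗᵢ ℝ E' E ℝ).toContinuousLinearEquiv.contDiff.contDiffAt.comp y hB
  have key' : ∀ B : E → E →L[ℝ] E' →L[ℝ] ℝ, ContDiffAt ℝ n B y →
      ContDiffAt ℝ n (fun z => (B z).flip) y := fun B hB =>
    (ContinuousLinearMap.flipₗᵢ ℝ E E' ℝ).toContinuousLinearEquiv.contDiff.contDiffAt.comp y hB
  have keyE : ∀ B : E → E →L[ℝ] E →L[ℝ] ℝ, ContDiffAt ℝ n B y →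
      ContDiffAt ℝ n (fun z => (B z).flip) y := fun B hB =>
    (ContinuousLinearMap.flipₗᵢ ℝ E E ℝ).toContinuousLinearEquiv.contDiff.contDiffAt.comp y hB
  exact keyE _ ((key' _ (hGφ.clm_comp hA)).clm_comp hA)

/-- The product rule for `z ↦ G (φ z) (Dφ_z v) (Dφ_z w)`. -/
theorem fderiv_coordPullback_apply {φ : E → E'} {G : E' → E' →L[ℝ] E' →L[ℝ] ℝ} {y : E}
    (hG : ContDiffAt ℝ 1 G (φ y)) (hφ : ContDiffAt ℝ 2 φ y) (u v w : E) :
    fderiv ℝ (coordPullback φ G) y u v w =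
      fderiv ℝ G (φ y) (fderiv ℝ φ y u) (fderiv ℝ φ y v) (fderiv ℝ φ y w)
        + G (φ y) (fderiv ℝ (fderiv ℝ φ) y u v) (fderiv ℝ φ y w)
        + G (φ y) (fderiv ℝ φ y v) (fderiv ℝ (fderiv ℝ φ) y u w) := by
  have hP : HasFDerivAt (coordPullback φ G) _ y :=
    ((hG.coordPullback hφ (by norm_num)).differentiableAt one_ne_zero).hasFDerivAt
  have h1 := (hP.clm_apply (hasFDerivAt_const v y)).clm_apply (hasFDerivAt_const w y)
  have hA : HasFDerivAt (fderiv ℝ φ) _ y :=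
    ((hφ.fderiv_right (m := 1) (by norm_num)).differentiableAt one_ne_zero).hasFDerivAt
  have hφ1 : HasFDerivAt φ _ y := (hφ.differentiableAt (by norm_num)).hasFDerivAt
  have hGφ := (hG.differentiableAt one_ne_zero).hasFDerivAt.comp y hφ1
  have h2 := (hGφ.clm_apply (hA.clm_apply (hasFDerivAt_const v y))).clm_apply
    (hA.clm_apply (hasFDerivAt_const w y))
  have h3 := congrArg (fun L => L u) (h1.unique h2)
  simp at h3
  rw [h3]
  ring

theorem fderiv_fderiv_symm {φ : E → E'} {y : E} (hφ : ContDiffAt ℝ 2 φ y) (u v : E) :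
    fderiv ℝ (fderiv ℝ φ) y u v = fderiv ℝ (fderiv ℝ φ) y v u :=
  hφ.isSymmSndFDerivAt (by simp [minSmoothness_of_isRCLikeNormedField]) u v

/-- The inhomogeneous transformation law of the Christoffel symbols of the first kind. -/
theorem koszulForm_coordPullback {φ : E → E'} {G : E' → E' →L[ℝ] E' →L[ℝ] ℝ} {y : E}
    (hG : ContDiffAt ℝ 1 G (φ y)) (hφ : ContDiffAt ℝ 2 φ y)
    (hsymm : ∀ u v, G (φ y) u v = G (φ y) v u) (u v w : E) :
    koszulForm (coordPullback φ G) y u v w =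
      koszulForm G (φ y) (fderiv ℝ φ y u) (fderiv ℝ φ y v) (fderiv ℝ φ y w)
        + 2 * G (φ y) (fderiv ℝ (fderiv ℝ φ) y u v) (fderiv ℝ φ y w) := by
  simp only [koszulForm_apply, fderiv_coordPullback_apply hG hφ]
  rw [fderiv_fderiv_symm hφ v u, fderiv_fderiv_symm hφ w u, fderiv_fderiv_symm hφ w v,
    hsymm (fderiv ℝ φ y v) (fderiv ℝ (fderiv ℝ φ) y u w)]
  ring

theorem apply_christoffel {G : E → E →L[ℝ] E →L[ℝ] ℝ} {y : E} (hG : (G y).IsInvertible)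
    (u v : E) : G y (christoffel G y u v) = (1 / 2 : ℝ) • koszulForm G y u v := by
  rw [christoffel_apply, map_smul, hG.self_apply_inverse]

theorem ContDiffAt.christoffel [CompleteSpace E] {G : E → E →L[ℝ] E →L[ℝ] ℝ} {y : E}
    {n m : WithTop ℕ∞}
    (hG : ContDiffAt ℝ m G y) (hnm : n + 1 ≤ m) (hinv : (G y).IsInvertible) :
    ContDiffAt ℝ n (christoffel G) y := by
  have hK : ContDiffAt ℝ n (koszulForm G) y := by
    have h1 : ContDiffAt ℝ n (fderiv ℝ G) y := hG.fderiv_right hnm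
    have h2 : ContDiffAt ℝ n (fun z => (fderiv ℝ G z).flip) y :=
      (ContinuousLinearMap.flipₗᵢ ℝ E E
        (E →L[ℝ] ℝ)).toContinuousLinearEquiv.contDiff.contDiffAt.comp y h1
    exact (h1.add h2).sub (contDiffAt_const.clm_comp h2)
  have hI : ContDiffAt ℝ n (fun z => (G z).inverse) y :=
    hinv.contDiffAt_map_inverse.comp y (hG.of_le (le_trans le_self_add hnm))
  have hL : ContDiffAt ℝ n
      (fun z => ContinuousLinearMap.compL ℝ E (E →L[ℝ] ℝ) E (G z).inverse) y :=
    (ContinuousLinearMap.compL ℝ E (E →L[ℝ] ℝ) E).contDiff.contDiffAt.comp y hI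
  exact (hL.clm_comp hK).const_smul (1 / 2 : ℝ)

theorem isInvertible_coordPullback {φ : E → E'} {G : E' → E' →L[ℝ] E' →L[ℝ] ℝ} {y : E}
    (hinv : (G (φ y)).IsInvertible) (hφ : (fderiv ℝ φ y).IsInvertible) :
    (coordPullback φ G y).IsInvertible := by
  obtain ⟨e, he⟩ := hinv
  obtain ⟨f, hf⟩ := hφ
  refine ⟨(f.trans e).trans (f.symm.arrowCongr (ContinuousLinearEquiv.refl ℝ ℝ)), ?_⟩
  ext u v
  simp [coordPullback_apply, ← he, ← hf]

/-- The transformation law `Dφ (Γ'(u, v)) = Γ(Dφ u, Dφ v) + D²φ(u, v)` of the Christoffel symbols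
under a change of coordinates. It follows from the law for the symbols of the first kind, as `G` is
nondegenerate. -/
theorem fderiv_christoffel_coordPullback {φ : E → E'} {G : E' → E' →L[ℝ] E' →L[ℝ] ℝ} {y : E}
    (hG : ContDiffAt ℝ 1 G (φ y)) (hφ : ContDiffAt ℝ 2 φ y)
    (hsymm : ∀ u v, G (φ y) u v = G (φ y) v u)
    (hinv : (G (φ y)).IsInvertible) (hφ' : (fderiv ℝ φ y).IsInvertible) (u v : E) :
    fderiv ℝ φ y (christoffel (coordPullback φ G) y u v) =
      christoffel G (φ y) (fderiv ℝ φ y u) (fderiv ℝ φ y v)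
        + fderiv ℝ (fderiv ℝ φ) y u v := by
  obtain ⟨e, he⟩ := id hinv
  apply e.injective
  rw [← ContinuousLinearEquiv.coe_coe, he]
  ext w'
  obtain ⟨w, rfl⟩ : ∃ w, fderiv ℝ φ y w = w' := hφ'.bijective.surjective w'
  rw [← coordPullback_apply, apply_christoffel (isInvertible_coordPullback hinv hφ'), map_add,
    apply_christoffel hinv]
  simp only [smul_apply, add_apply, koszulForm_coordPullback hG hφ hsymm,
    smul_eq_mul]
  ring

/-- The curvature is natural under changes of coordinates. Differentiating the transformation law of
the Christoffel symbols and antisymmetrizing, the inhomogeneous terms cancel by the symmetry of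
`D²φ` and of `D²(Dφ)`. -/
theorem fderiv_coordCurvature_coordPullback [CompleteSpace E] [CompleteSpace E']
    {φ : E → E'} {G : E' → E' →L[ℝ] E' →L[ℝ] ℝ} {y : E}
    (hG : ContDiffAt ℝ 2 G (φ y)) (hφ : ContDiffAt ℝ 3 φ y)
    (hsymm : ∀ᶠ z in 𝓝 (φ y), ∀ u v, G z u v = G z v u)
    (hinv : (G (φ y)).IsInvertible) (hφ' : (fderiv ℝ φ y).IsInvertible) (u v w : E) :
    fderiv ℝ φ y (coordCurvature (coordPullback φ G) y v w u) =
      coordCurvature G (φ y) (fderiv ℝ φ y v) (fderiv ℝ φ y w) (fderiv ℝ φ y u) := by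
  have hA : ContDiffAt ℝ 2 (fderiv ℝ φ) y := hφ.fderiv_right (by norm_num)
  -- The transformation law of the Christoffel symbols holds near `y`, hence can be differentiated.
  have hev : ∀ᶠ z in 𝓝 y, ∀ a b : E,
      fderiv ℝ φ z (christoffel (coordPullback φ G) z a b) =
        christoffel G (φ z) (fderiv ℝ φ z a) (fderiv ℝ φ z b) + fderiv ℝ (fderiv ℝ φ) z a b := by
    have hopen : ∀ᶠ z in 𝓝 y, (G (φ z)).IsInvertible ∧ (fderiv ℝ φ z).IsInvertible := by
      refine Filter.Eventually.and ?_ ?_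
      · obtain ⟨e, he⟩ := hinv
        have := e.nhds
        rw [he] at this
        exact (hG.continuousAt.comp hφ.continuousAt) this
      · obtain ⟨e, he⟩ := hφ'
        have := e.nhds
        rw [he] at this
        exact hA.continuousAt this
    filter_upwards [hopen, hφ.eventually (by norm_num),
      hφ.continuousAt (hG.eventually (by norm_num)),
      hφ.continuousAt hsymm] with z hz hz1 hz2 hz3 a b
    have hz2 : ContDiffAt ℝ 2 G (φ z) := hz2
    exact fderiv_christoffel_coordPullback (hz2.of_le (by norm_num))
      (hz1.of_le (by norm_num)) hz3 hz.1 hz.2 a b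
  have hΓ' : HasFDerivAt (christoffel (coordPullback φ G)) _ y :=
    (((hG.coordPullback hφ (by norm_num)).christoffel (n := 1) (by norm_num)
      (isInvertible_coordPullback hinv hφ')).differentiableAt one_ne_zero).hasFDerivAt
  have hφ1 : HasFDerivAt φ _ y := (hφ.differentiableAt (by norm_num)).hasFDerivAt
  have hΓ : HasFDerivAt (fun z => christoffel G (φ z)) _ y :=
    ((hG.christoffel (n := 1) (by norm_num) hinv).differentiableAt
      one_ne_zero).hasFDerivAt.comp y hφ1
  have hA1 : HasFDerivAt (fderiv ℝ φ) _ y := (hA.differentiableAt (by norm_num)).hasFDerivAt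
  have hA2 : HasFDerivAt (fderiv ℝ (fderiv ℝ φ)) _ y :=
    ((hA.fderiv_right (m := 1) (by norm_num)).differentiableAt one_ne_zero).hasFDerivAt
  have hD : ∀ a b c : E, fderiv ℝ (fderiv ℝ φ) y a (christoffel (coordPullback φ G) y b c)
      + fderiv ℝ φ y (fderiv ℝ (christoffel (coordPullback φ G)) y a b c) =
      fderiv ℝ (christoffel G) (φ y) (fderiv ℝ φ y a) (fderiv ℝ φ y b) (fderiv ℝ φ y c)
      + christoffel G (φ y) (fderiv ℝ (fderiv ℝ φ) y a b) (fderiv ℝ φ y c)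
      + christoffel G (φ y) (fderiv ℝ φ y b) (fderiv ℝ (fderiv ℝ φ) y a c)
      + fderiv ℝ (fderiv ℝ (fderiv ℝ φ)) y a b c := by
    intro a b c
    have hL := hA1.clm_apply
      ((hΓ'.clm_apply (hasFDerivAt_const b y)).clm_apply (hasFDerivAt_const c y))
    have hR := ((hΓ.clm_apply (hA1.clm_apply (hasFDerivAt_const b y))).clm_apply
      (hA1.clm_apply (hasFDerivAt_const c y))).add
      ((hA2.clm_apply (hasFDerivAt_const b y)).clm_apply (hasFDerivAt_const c y))
    have h := congrArg (fun L => L a)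
      ((hL.congr_of_eventuallyEq (hev.mono fun z hz => (hz b c).symm)).unique hR)
    simp at h
    rw [add_comm, h]
    abel
  have hΓy := fun a b => hev.self_of_nhds a b
  have h2 : ∀ a b, fderiv ℝ (fderiv ℝ φ) y a b = fderiv ℝ (fderiv ℝ φ) y b a :=
    fderiv_fderiv_symm (hφ.of_le (by norm_num))
  have h3 := congrArg (fun L => L w) (fderiv_fderiv_symm hA u v)
  have e1 := hD u v w
  have e2 := hD v u w
  rw [← eq_sub_iff_add_eq'] at e1 e2
  simp only [coordCurvature, LinearMap.coe_mk, AddHom.coe_mk, map_add, map_sub, e1, e2, hΓy]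
  rw [h3, h2 v u]
  abel

/-- The Ricci tensor is natural under changes of coordinates. -/
theorem coordRicci_coordPullback [FiniteDimensional ℝ E] [FiniteDimensional ℝ E']
    {φ : E → E'} {G : E' → E' →L[ℝ] E' →L[ℝ] ℝ} {y : E}
    (hG : ContDiffAt ℝ 2 G (φ y)) (hφ : ContDiffAt ℝ 3 φ y)
    (hsymm : ∀ᶠ z in 𝓝 (φ y), ∀ u v, G z u v = G z v u)
    (hinv : (G (φ y)).IsInvertible) (hφ' : (fderiv ℝ φ y).IsInvertible) (v w : E) :
    coordRicci (coordPullback φ G) y v w =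
      coordRicci G (φ y) (fderiv ℝ φ y v) (fderiv ℝ φ y w) := by
  have := FiniteDimensional.complete ℝ E
  have := FiniteDimensional.complete ℝ E'
  have hcurv := fderiv_coordCurvature_coordPullback hG hφ hsymm hinv hφ'
  obtain ⟨e, he⟩ := hφ'
  rw [coordRicci, coordRicci,
    ← LinearMap.trace_conj' (coordCurvature (coordPullback φ G) y v w) e.toLinearEquiv]
  congr 1
  ext u'
  obtain ⟨u, rfl⟩ := e.surjective u'
  have := hcurv u v w
  rw [← he] at this ⊢
  simpa [LinearEquiv.conj_apply] using this

theorem Filter.EventuallyEq.christoffel {G₁ G₂ : E → E →L[ℝ] E →L[ℝ] ℝ} {y : E}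
    (h : G₁ =ᶠ[𝓝 y] G₂) : christoffel G₁ =ᶠ[𝓝 y] christoffel G₂ := by
  filter_upwards [h, h.fderiv (𝕜 := ℝ)] with z hz hz'
  simp only [_root_.christoffel, koszulForm, hz, hz']

theorem Filter.EventuallyEq.coordRicci_eq {G₁ G₂ : E → E →L[ℝ] E →L[ℝ] ℝ} {y : E}
    (h : G₁ =ᶠ[𝓝 y] G₂) : coordRicci G₁ y = coordRicci G₂ y := by
  ext v w
  rw [coordRicci, coordRicci]
  congr 1
  ext u
  simp [coordCurvature, h.christoffel.fderiv_eq, h.christoffel.eq_of_nhds]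

/-- A definite bilinear form on a finite-dimensional space is nondegenerate. -/
theorem ContinuousLinearMap.isInvertible_of_pos [FiniteDimensional ℝ E] (B : E →L[ℝ] E →L[ℝ] ℝ)
    (hpos : ∀ u, u ≠ 0 → 0 < B u u) : B.IsInvertible := by
  have hinj : Function.Injective B.toLinearMap := by
    rw [← LinearMap.ker_eq_bot, LinearMap.ker_eq_bot']
    intro u hu
    by_contra hne
    have h := hpos u hne
    have hu' : B u = 0 := hu
    simp [hu'] at h
  have hrank : Module.finrank ℝ E = Module.finrank ℝ (E →L[ℝ] ℝ) := by
    rw [← (LinearMap.toContinuousLinearMap (𝕜 := ℝ) (E := E) (F' := ℝ)).finrank_eq]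
    exact (Subspace.dual_finrank_eq).symm
  refine ⟨(LinearEquiv.ofInjectiveOfFinrankEq B.toLinearMap hinj hrank).toContinuousLinearEquiv, ?_⟩
  ext u v
  rfl

end CoordinatePullback

/-! ### Pullback of 2-tensors and naturality of the Ricci tensor -/

section TensorPullback

open Filter Topology

variable {E : Type*} [NormedAddCommGroup E] [NormedSpace ℝ E]
  {H : Type*} [TopologicalSpace H] {I : ModelWithCorners ℝ E H}
  {E' : Type*} [NormedAddCommGroup E'] [NormedSpace ℝ E']
  {H' : Type*} [TopologicalSpace H'] {I' : ModelWithCorners ℝ E' H'}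
  {E'' : Type*} [NormedAddCommGroup E''] [NormedSpace ℝ E'']
  {H'' : Type*} [TopologicalSpace H''] {I'' : ModelWithCorners ℝ E'' H''}
  {N : Type*} [TopologicalSpace N] [ChartedSpace H N]
  {N' : Type*} [TopologicalSpace N'] [ChartedSpace H' N']
  {N'' : Type*} [TopologicalSpace N''] [ChartedSpace H'' N'']

theorem TwoTensor.pullback_apply (F : N → N') (h : TwoTensor I' N') (p : N)
    (u v : TangentSpace I p) :
    h.pullback I F p u v = h (F p) (mfderiv I I' F p u) (mfderiv I I' F p v) := rfl

theorem TwoTensor.pullback_comp {f : N → N'} {g : N' → N''} (h : TwoTensor I'' N'') {p : N}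
    (hg : MDifferentiableAt I' I'' g (f p)) (hf : MDifferentiableAt I I' f p) :
    h.pullback I (g ∘ f) p = (h.pullback I' g).pullback I f p := by
  ext u v
  simp only [TwoTensor.pullback_apply, mfderiv_comp p hg hf]
  rfl

theorem TwoTensor.pullback_id (h : TwoTensor I N) : h.pullback I id = h := by
  ext p u v
  simp only [TwoTensor.pullback_apply, mfderiv_id]
  rfl

/-- The pullback at a point depends only on the germ of the map. -/
theorem TwoTensor.pullback_congr {f g : N → N'} (h : TwoTensor I' N') {p : N}
    (hfg : f =ᶠ[𝓝 p] g) : h.pullback I f p = h.pullback I g p := by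
  -- Tangent spaces at equal points are identified through the model space.
  have key : ∀ {x y : N'} (A B : E →L[ℝ] E'), x = y → A = B → ∀ u v : E,
      (show LinearMap.BilinForm ℝ E' from h x) (A u) (A v) =
        (show LinearMap.BilinForm ℝ E' from h y) (B u) (B v) := by
    rintro x y A B rfl rfl u v
    rfl
  ext u v
  exact key _ _ hfg.eq_of_nhds hfg.mfderiv_eq u v

/-- In the preferred charts at `p` and `F p`, the pullback of a tensor is the pullback of its
expression under the coordinate expression of `F`. -/
theorem TwoTensor.inChart_pullback [FiniteDimensional ℝ E] [FiniteDimensional ℝ E']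
    [I.Boundaryless] [I'.Boundaryless] [IsManifold I 1 N] [IsManifold I' 1 N']
    {F : N → N'} (h : TwoTensor I' N') {p : N} (hF : ContMDiffAt I I' 1 F p) :
    (h.pullback I F).inChart p =ᶠ[𝓝 (extChartAt I p p)]
      coordPullback (writtenInExtChartAt I I' p F) (h.inChart (F p)) := by
  have hsymm : Tendsto (extChartAt I p).symm (𝓝 (extChartAt I p p)) (𝓝 p) := by
    simpa using (continuousAt_extChartAt_symm (I := I) p).tendsto
  have h1 := hsymm.eventually ((contMDiffAt_iff_contMDiffAt_nhds (by simp)).mp hF)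
  have h2 := hsymm.eventually (hF.continuousAt (extChartAt_source_mem_nhds (I := I') (F p)))
  have h3 := extChartAt_target_mem_nhds (I := I) p
  filter_upwards [h1, eventually_eventually_nhds.mpr h2, h3] with y hy1 hy2 hy3
  have e1 : MDifferentiableAt 𝓘(ℝ, E) I (extChartAt I p).symm y :=
    (contMDiffOn_extChartAt_symm (n := 1) p).contMDiffAt
      ((isOpen_extChartAt_target p).mem_nhds hy3) |>.mdifferentiableAt one_ne_zero
  have e2 : MDifferentiableAt I I' F ((extChartAt I p).symm y) :=
    hy1.mdifferentiableAt one_ne_zero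
  have e3 : F ((extChartAt I p).symm y) ∈ (extChartAt I' (F p)).source := hy2.self_of_nhds
  have e4 : MDifferentiableAt I' 𝓘(ℝ, E') (extChartAt I' (F p)) (F ((extChartAt I p).symm y)) :=
    mdifferentiableAt_extChartAt (by simpa using e3)
  have e5 : MDifferentiableAt 𝓘(ℝ, E) 𝓘(ℝ, E') (writtenInExtChartAt I I' p F) y :=
    e4.comp y (e2.comp y e1)
  have e6 : MDifferentiableAt 𝓘(ℝ, E') I' (extChartAt I' (F p)).symm
      (writtenInExtChartAt I I' p F y) :=
    (contMDiffOn_extChartAt_symm (n := 1) (F p)).contMDiffAt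
      ((isOpen_extChartAt_target (F p)).mem_nhds ((extChartAt I' (F p)).map_source e3))
      |>.mdifferentiableAt one_ne_zero
  have e7 : F ∘ (extChartAt I p).symm =ᶠ[𝓝 y]
      (extChartAt I' (F p)).symm ∘ writtenInExtChartAt I I' p F := by
    filter_upwards [hy2] with z hz
    exact ((extChartAt I' (F p)).left_inv hz).symm
  have key : TwoTensor.pullback 𝓘(ℝ, E) (extChartAt I p).symm (h.pullback I F) y =
      (TwoTensor.pullback 𝓘(ℝ, E') (extChartAt I' (F p)).symm h).pullback 𝓘(ℝ, E)
        (writtenInExtChartAt I I' p F) y := by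
    rw [← TwoTensor.pullback_comp h e2 e1, ← TwoTensor.pullback_comp h e6 e5]
    exact TwoTensor.pullback_congr h e7
  ext u v
  rw [coordPullback_apply, ← mfderiv_eq_fderiv]
  exact congrArg (fun B : LinearMap.BilinForm ℝ E => B u v) key

/-- The Ricci tensor of a Riemannian metric is natural under local diffeomorphisms. -/
theorem ricci_pullback [FiniteDimensional ℝ E] [FiniteDimensional ℝ E']
    [I.Boundaryless] [I'.Boundaryless] [IsManifold I ∞ N] [IsManifold I' ∞ N']
    {F : N → N'} {h : TwoTensor I' N'} {p : N} (hF : ContMDiffAt I I' ∞ F p)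
    (hF' : (mfderiv I I' F p).IsInvertible)
    (hsymm : ∀ (q : N') (u v : TangentSpace I' q), h q u v = h q v u)
    (hpos : ∀ (q : N') (u : TangentSpace I' q), u ≠ 0 → 0 < h q u u)
    (hsmooth : ContDiffAt ℝ 2 (h.inChart (F p)) (extChartAt I' (F p) (F p)))
    (u v : TangentSpace I p) :
    ricci (h.pullback I F) p u v = ricci h (F p) (mfderiv I I' F p u) (mfderiv I I' F p v) := by
  set φ := writtenInExtChartAt I I' p F with hφdef
  have hφy : φ (extChartAt I p p) = extChartAt I' (F p) (F p) := by simp [hφdef]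
  have hφ : ContDiffAt ℝ ∞ φ (extChartAt I p p) := by
    have := (contMDiffAt_iff.mp hF).2
    rwa [I.range_eq_univ, contDiffWithinAt_univ] at this
  have hFd := hF.mdifferentiableAt (by simp)
  have hd : mfderiv I 𝓘(ℝ, E') (extChartAt I' (F p) ∘ F) p =
      mfderiv I 𝓘(ℝ, E') (φ ∘ extChartAt I p) p := by
    refine Filter.EventuallyEq.mfderiv_eq ?_
    filter_upwards [extChartAt_source_mem_nhds (I := I) p] with q hq
    simp only [hφdef, writtenInExtChartAt, Function.comp_apply, (extChartAt I p).left_inv hq]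
  have hd1 : MDifferentiableAt I' 𝓘(ℝ, E') (extChartAt I' (F p)) (F p) :=
    mdifferentiableAt_extChartAt (by simp)
  have hd2 : MDifferentiableAt I 𝓘(ℝ, E) (extChartAt I p) p :=
    mdifferentiableAt_extChartAt (by simp)
  have hd3 : MDifferentiableAt 𝓘(ℝ, E) 𝓘(ℝ, E') φ (extChartAt I p p) :=
    (hφ.differentiableAt (by simp)).mdifferentiableAt
  rw [mfderiv_comp p hd1 hFd, mfderiv_comp p hd3 hd2, mfderiv_eq_fderiv] at hd
  have hd' : ∀ w : TangentSpace I p,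
      mfderiv I' 𝓘(ℝ, E') (extChartAt I' (F p)) (F p) (mfderiv I I' F p w) =
        fderiv ℝ φ (extChartAt I p p) (mfderiv I 𝓘(ℝ, E) (extChartAt I p) p w) :=
    fun w => congrArg (fun L : E →L[ℝ] E' => L w) hd
  have hc' := isInvertible_mfderiv_extChartAt (I := I') (mem_extChartAt_source (I := I') (F p))
  have hc := isInvertible_mfderiv_extChartAt (I := I) (mem_extChartAt_source (I := I) p)
  have hφ' : (fderiv ℝ φ (extChartAt I p p)).IsInvertible := by
    have h1 := hc'.comp hF'
    rw [hd] at h1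
    obtain ⟨c, hc⟩ := hc
    rw [← hc] at h1
    exact ContinuousLinearMap.isInvertible_comp_equiv.mp h1
  have hinv : (h.inChart (F p) (φ (extChartAt I p p))).IsInvertible := by
    rw [hφy]
    refine ContinuousLinearMap.isInvertible_of_pos _ fun w hw => hpos _ _ fun h0 => hw ?_
    have hs := isInvertible_mfderivWithin_extChartAt_symm (I := I')
      (mem_extChartAt_target (I := I') (F p))
    rw [I'.range_eq_univ, mfderivWithin_univ] at hs
    exact hs.injective (h0.trans (map_zero _).symm)
  rw [ricci, ricci, (TwoTensor.inChart_pullback h (hF.of_le (by simp))).coordRicci_eq, hd', hd',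
    ← hφy]
  rw [← hφy] at hsmooth
  exact coordRicci_coordPullback hsmooth (hφ.of_le (by norm_cast))
    (.of_forall fun z a b => hsymm _ _ _) hinv hφ' _ _

end TensorPullback

/-! ### Smoothness of tensor fields -/

section SmoothTensors

open Filter Topology

variable {E : Type*} [NormedAddCommGroup E] [NormedSpace ℝ E]
  {H : Type*} [TopologicalSpace H] {I : ModelWithCorners ℝ E H}
  {N : Type*} [TopologicalSpace N] [ChartedSpace H N]
  {E' : Type*} [NormedAddCommGroup E'] [NormedSpace ℝ E']
  {H' : Type*} [TopologicalSpace H'] {I' : ModelWithCorners ℝ E' H'}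
  {N' : Type*} [TopologicalSpace N'] [ChartedSpace H' N']
  {A B : Type*} [NormedAddCommGroup A] [NormedSpace ℝ A] [NormedAddCommGroup B] [NormedSpace ℝ B]

/-- A family of continuous linear maps on a finite-dimensional space is smooth if all its
evaluations are. -/
theorem ContMDiffAt.of_clm_apply [FiniteDimensional ℝ A] {n : WithTop ℕ∞} {f : N → A →L[ℝ] B}
    {x : N} (h : ∀ v, ContMDiffAt I 𝓘(ℝ, B) n (fun y => f y v) x) :
    ContMDiffAt I 𝓘(ℝ, A →L[ℝ] B) n f x := by
  let b := Module.finBasis ℝ A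
  have hf : f = fun y => ∑ i, ContinuousLinearMap.smulRightL ℝ A B
      (LinearMap.toContinuousLinearMap (b.coord i)) (f y (b i)) := by
    ext y v
    conv_lhs => rw [← b.sum_repr v, map_sum]
    simp
  rw [hf]
  exact ContMDiffAt.sum fun i _ =>
    (ContinuousLinearMap.contDiff _).contMDiff.contMDiffAt.comp x (h (b i))

/-- A field of bilinear forms on the tangent spaces is smooth if its values on smooth local
vector fields are smooth. -/
theorem contMDiffAt_bilin_section [FiniteDimensional ℝ E] [IsManifold I ∞ N]
    (s : ∀ x : N, TangentSpace I x →L[ℝ] TangentSpace I x →L[ℝ] ℝ) (x₀ : N)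
    (hs : ∀ X Y : ∀ x : N, TangentSpace I x,
      ContMDiffAt I I.tangent ∞ (fun x => (⟨x, X x⟩ : TangentBundle I N)) x₀ →
      ContMDiffAt I I.tangent ∞ (fun x => (⟨x, Y x⟩ : TangentBundle I N)) x₀ →
      ContMDiffAt I 𝓘(ℝ, ℝ) ∞ (fun x => s x (X x) (Y x)) x₀) :
    ContMDiffAt I (I.prod 𝓘(ℝ, E →L[ℝ] E →L[ℝ] ℝ)) ∞
      (fun x => Bundle.TotalSpace.mk' (E →L[ℝ] E →L[ℝ] ℝ)
        (E := fun x : N => TangentSpace I x →L[ℝ] TangentSpace I x →L[ℝ] ℝ) x (s x)) x₀ := by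
  -- Test on the frame of a local trivialization: its constant sections are smooth vector fields.
  rw [Bundle.contMDiffAt_section]
  set e := trivializationAt E (TangentSpace I) x₀ with he
  have hbase : e.baseSet ∈ 𝓝 x₀ :=
    e.open_baseSet.mem_nhds (FiberBundle.mem_baseSet_trivializationAt' x₀)
  have hX : ∀ u : E, ContMDiffAt I I.tangent ∞
      (fun x => (⟨x, e.symm x u⟩ : TangentBundle I N)) x₀ := by
    intro u
    refine (Bundle.contMDiffAt_section x₀).mpr ?_
    refine (contMDiffAt_const (c := u)).congr_of_eventuallyEq ?_
    filter_upwards [hbase] with x hx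
    rw [← he, e.apply_mk_symm hx]
  refine ContMDiffAt.of_clm_apply fun u => ContMDiffAt.of_clm_apply fun v => ?_
  refine (hs _ _ (hX u) (hX v)).congr_of_eventuallyEq ?_
  filter_upwards [hbase] with x hx
  rw [hom_trivializationAt_apply]
  exact (inCoordinates_apply_eq₂ (𝕜 := ℝ) (F₃ := ℝ) (E₃ := Bundle.Trivial N ℝ) (ϕ := s x)
    hx hx (Set.mem_univ _)).trans (by simp [he])

/-- A smooth metric is smooth on pairs of vector fields along a map. Unlike
`ContMDiffAt.inner_bundle`, this does not require `g` to be registered as an instance. -/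
theorem Bundle.ContMDiffRiemannianMetric.contMDiffAt_inner [IsManifold I ∞ N]
    (g : Bundle.ContMDiffRiemannianMetric I ∞ E (fun x : N => TangentSpace I x))
    {b : N' → N} {v w : ∀ x, TangentSpace I (b x)} {x : N'}
    (hv : ContMDiffAt I' I.tangent ∞ (fun y => (⟨b y, v y⟩ : TangentBundle I N)) x)
    (hw : ContMDiffAt I' I.tangent ∞ (fun y => (⟨b y, w y⟩ : TangentBundle I N)) x) :
    ContMDiffAt I' 𝓘(ℝ, ℝ) ∞ (fun y => g.inner (b y) (v y) (w y)) x := by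
  have hb : ContMDiffAt I' I ∞ b x := (Bundle.contMDiffAt_totalSpace.mp hv).1
  have := ContMDiffAt.clm_bundle_apply₂ (F₃ := ℝ) (E₃ := Bundle.Trivial N ℝ)
    (g.contMDiff.contMDiffAt.comp x hb) hv hw
  exact (Bundle.contMDiffAt_totalSpace.mp this).2

/-- Version of `ContMDiff.contMDiff_tangentMap` for a map that is smooth on an open set only. -/
theorem ContMDiffOn.contMDiffAt_tangentMap [IsManifold I ∞ N] [IsManifold I' ∞ N']

    {f : N → N'} {s : Set N} (hs : IsOpen s) (hf : ContMDiffOn I I' ∞ f s)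
    {X : TangentBundle I N} (hX : X.proj ∈ s) :
    ContMDiffAt I.tangent I'.tangent ∞ (tangentMap I I' f) X := by
  have h := hf.contMDiffOn_tangentMapWithin (m := ∞) (by simp) hs.uniqueMDiffOn
  have hmem : Bundle.TotalSpace.proj ⁻¹' s ∈ 𝓝 X :=
    (hs.preimage (FiberBundle.continuous_proj E (TangentSpace I))).mem_nhds hX
  refine (h.contMDiffAt hmem).congr_of_eventuallyEq ?_
  filter_upwards [hmem] with Y hY
  exact (tangentMapWithin_eq_tangentMap (hs.uniqueMDiffOn _ hY)
    ((hf.contMDiffAt (hs.mem_nhds hY)).mdifferentiableAt (by simp))).symm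

/-- The coordinate vector fields of a chart are smooth. -/
theorem contMDiffAt_coordinateField [I.Boundaryless] [IsManifold I ∞ N]
    (p : N) (u : E) {y : E} (hy : y ∈ (extChartAt I p).target) :
    ContMDiffAt 𝓘(ℝ, E) I.tangent ∞ (fun z => (⟨(extChartAt I p).symm z,
      mfderiv 𝓘(ℝ, E) I (extChartAt I p).symm z u⟩ : TangentBundle I N)) y := by
  have h1 : ContMDiffAt 𝓘(ℝ, E) 𝓘(ℝ, E).tangent ∞
      (fun z => (⟨z, u⟩ : TangentBundle 𝓘(ℝ, E) E)) y :=
    contMDiffAt_vectorSpace_iff_contDiffAt.mpr contDiffAt_const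
  exact ((contMDiffOn_extChartAt_symm p).contMDiffAt_tangentMap (isOpen_extChartAt_target p)
    (X := ⟨y, u⟩) hy).comp y h1

/-- The chart expression of a 2-tensor is smooth if the tensor is smooth on vector fields along
smooth maps. -/
theorem TwoTensor.contDiffAt_inChart [FiniteDimensional ℝ E] [I.Boundaryless] [IsManifold I ∞ N]
    (h : TwoTensor I N)
    (hh : ∀ (b : E → N) (v w : ∀ y, TangentSpace I (b y)) (y : E),
      ContMDiffAt 𝓘(ℝ, E) I.tangent ∞ (fun z => (⟨b z, v z⟩ : TangentBundle I N)) y →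
      ContMDiffAt 𝓘(ℝ, E) I.tangent ∞ (fun z => (⟨b z, w z⟩ : TangentBundle I N)) y →
      ContMDiffAt 𝓘(ℝ, E) 𝓘(ℝ, ℝ) ∞ (fun z => h (b z) (v z) (w z)) y)
    (p : N) {y : E} (hy : y ∈ (extChartAt I p).target) :
    ContDiffAt ℝ ∞ (h.inChart p) y := by
  rw [← contMDiffAt_iff_contDiffAt]
  exact ContMDiffAt.of_clm_apply fun u => ContMDiffAt.of_clm_apply fun v =>
    hh _ _ _ y (contMDiffAt_coordinateField p u hy) (contMDiffAt_coordinateField p v hy)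

/-- The pullback of a Riemannian metric under a smooth map whose differentials are
invertible. -/
def Bundle.ContMDiffRiemannianMetric.pullback [FiniteDimensional ℝ E]
    [IsManifold I ∞ N] [IsManifold I' ∞ N']
    (g : Bundle.ContMDiffRiemannianMetric I' ∞ E' (fun x : N' => TangentSpace I' x))
    (f : N → N') (hf : ContMDiff I I' ∞ f) (hf' : ∀ x, (mfderiv I I' f x).IsInvertible) :
    Bundle.ContMDiffRiemannianMetric I ∞ E (fun x : N => TangentSpace I x) where
  inner x := ((mfderiv I I' f x).precomp ℝ).comp ((g.inner (f x)).comp (mfderiv I I' f x))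
  symm x v w := g.symm _ _ _
  pos x v hv := g.pos _ _ fun h => hv ((hf' x).injective (h.trans (map_zero _).symm))
  isVonNBounded x := by
    obtain ⟨e, he⟩ := hf' x
    have h := (g.isVonNBounded (f x)).image (e.symm : TangentSpace I' (f x) →L[ℝ] TangentSpace I x)
    rw [← he]
    refine h.subset fun v hv => ?_
    exact ⟨e v, hv, e.symm_apply_apply v⟩
  contMDiff x₀ := by
    refine contMDiffAt_bilin_section _ x₀ fun X Y hX hY => ?_
    have hT := hf.contMDiff_tangentMap (m := ∞) (by simp)
    exact g.contMDiffAt_inner (b := f) (v := fun x => mfderiv I I' f x (X x))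
      (w := fun x => mfderiv I I' f x (Y x)) (hT.contMDiffAt.comp x₀ hX) (hT.contMDiffAt.comp x₀ hY)

end SmoothTensors

/-! ### Diffeomorphisms -/

section InverseMaps

variable {E : Type*} [NormedAddCommGroup E] [NormedSpace ℝ E]
  {H : Type*} [TopologicalSpace H] {I : ModelWithCorners ℝ E H}
  {N : Type*} [TopologicalSpace N] [ChartedSpace H N]
  {E' : Type*} [NormedAddCommGroup E'] [NormedSpace ℝ E']
  {H' : Type*} [TopologicalSpace H'] {I' : ModelWithCorners ℝ E' H'}
  {N' : Type*} [TopologicalSpace N'] [ChartedSpace H' N']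

theorem mfderiv_leftInverse_apply {f : N → N'} {g : N' → N} (hf : MDifferentiable I I' f)
    (hg : MDifferentiable I' I g) (hgf : Function.LeftInverse g f) (p : N)
    (u : TangentSpace I p) : mfderiv I' I g (f p) (mfderiv I I' f p u) = u := by
  have h := mfderiv_comp_apply p (hg (f p)) (hf p) u
  rw [hgf.comp_eq_id] at h
  refine h.symm.trans ?_
  rw [mfderiv_id]
  rfl

theorem isInvertible_mfderiv_of_inverse {f : N → N'} {g : N' → N} (hf : MDifferentiable I I' f)
    (hg : MDifferentiable I' I g) (hgf : Function.LeftInverse g f)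
    (hfg : Function.RightInverse g f) (p : N) : (mfderiv I I' f p).IsInvertible := by
  refine ContinuousLinearMap.IsInvertible.of_inverse (g := mfderiv I' I g (f p)) ?_ ?_
  · ext u
    have h := mfderiv_comp_apply_of_eq (f p) (hf p) (hg (f p)) (hgf p) u
    rw [hfg.comp_eq_id] at h
    refine h.symm.trans ?_
    rw [mfderiv_id]
  · ext u
    exact mfderiv_leftInverse_apply hf hg hgf p u

theorem Diffeomorph.isInvertible_mfderiv (F : N ≃ₘ^∞⟮I, I'⟯ N') (p : N) :
    (mfderiv I I' F p).IsInvertible :=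
  isInvertible_mfderiv_of_inverse (F.contMDiff.mdifferentiable (by simp))
    (F.symm.contMDiff.mdifferentiable (by simp)) F.symm_apply_apply F.apply_symm_apply p

/-- Pulling back under a diffeomorphism is undone by pulling back under its inverse. -/
theorem TwoTensor.pullback_symm_pullback (F : N ≃ₘ^∞⟮I, I'⟯ N') (h : TwoTensor I' N') :
    (h.pullback I F).pullback I' F.symm = h := by
  funext p
  rw [← TwoTensor.pullback_comp h (F.contMDiff.mdifferentiable (by simp) _)
    (F.symm.contMDiff.mdifferentiable (by simp) p)]
  have : F ∘ F.symm = id := funext F.apply_symm_apply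
  rw [this, TwoTensor.pullback_id]

end InverseMaps

/-! ### Automorphisms of principal bundles -/

section PrincipalBundleGeometry

open Filter Topology

variable {EM : Type*} [NormedAddCommGroup EM] [NormedSpace ℝ EM]
  {HM : Type*} [TopologicalSpace HM] {IM : ModelWithCorners ℝ EM HM}
  {EG : Type*} [NormedAddCommGroup EG] [NormedSpace ℝ EG]
  {HG : Type*} [TopologicalSpace HG] {IG : ModelWithCorners ℝ EG HG}
  {EP : Type*} [NormedAddCommGroup EP] [NormedSpace ℝ EP]
  {HP : Type*} [TopologicalSpace HP] {IP : ModelWithCorners ℝ EP HP}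
  {M : Type*} [TopologicalSpace M] [ChartedSpace HM M]
  {G : Type*} [TopologicalSpace G] [ChartedSpace HG G] [Group G]
  {P : Type*} [TopologicalSpace P] [ChartedSpace HP P] [MulAction Gᵐᵒᵖ P]
  {proj : P → M}

theorem IsPrincipalBundle.surjective (hproj : IsPrincipalBundle IM IG IP (G := G) proj) :
    Function.Surjective proj := fun x => by
  obtain ⟨e, hx, -⟩ := hproj.exists_trivialization x
  exact ⟨e.toOpenPartialHomeomorph.symm (x, 1), e.proj_symm_apply' hx⟩

/-- The structure group acts transitively on the fibres. -/
theorem IsPrincipalBundle.exists_smul_eq (hproj : IsPrincipalBundle IM IG IP (G := G) proj)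
    {p q : P} (h : proj p = proj q) : ∃ g : G, MulOpposite.op g • p = q := by
  obtain ⟨e, hx, -, -, he⟩ := hproj.exists_trivialization (proj p)
  have hp : p ∈ e.source := e.mem_source.mpr hx
  have hq : q ∈ e.source := e.mem_source.mpr (h ▸ hx)
  refine ⟨(e p).2⁻¹ * (e q).2, ?_⟩
  have hpg : MulOpposite.op ((e p).2⁻¹ * (e q).2) • p ∈ e.source :=
    e.mem_source.mpr ((hproj.proj_action p _).symm ▸ hx)
  refine e.injOn hpg hq (show e _ = e _ from Prod.ext ?_ ?_)
  · rw [e.coe_fst hpg, e.coe_fst hq, hproj.proj_action, h]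
  · rw [he p hp, mul_inv_cancel_left]

theorem IsPrincipalBundle.contMDiff_smul (hproj : IsPrincipalBundle IM IG IP (G := G) proj)
    (g : G) : ContMDiff IP IP ∞ (fun p : P => MulOpposite.op g • p) :=
  hproj.contMDiff_action.comp (contMDiff_id.prodMk contMDiff_const)

theorem IsPrincipalBundle.contMDiff_orbit (hproj : IsPrincipalBundle IM IG IP (G := G) proj)
    (p : P) : ContMDiff IG IP ∞ (fun g : G => MulOpposite.op g • p) :=
  hproj.contMDiff_action.comp (contMDiff_const.prodMk contMDiff_id)

/-- Every vertical vector is the value of a fundamental vector field: near `p` the identity of `P`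
is `q ↦ σ (proj q) · γ q` for a local section `σ` through `p`, and the first factor has derivative
zero along vertical vectors. -/
theorem IsPrincipalBundle.exists_fundamentalVector_eq [LieGroup IG ∞ G]
    (hproj : IsPrincipalBundle IM IG IP (G := G) proj) {p : P} {u : TangentSpace IP p}
    (hu : mfderiv IP IM proj p u = 0) :
    ∃ z : GroupLieAlgebra IG G, fundamentalVector IG IP p z = u := by
  obtain ⟨e, hx, he1, he2, he⟩ := hproj.exists_trivialization (proj p)
  have hp : p ∈ e.source := e.mem_source.mpr hx
  set a := (e p).2 with ha
  set σ : M → P := fun x => e.toOpenPartialHomeomorph.symm (x, a) with hσ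
  set γ : P → G := fun q => a⁻¹ * (e q).2 with hγ
  have hep : e p = (proj p, a) := Prod.ext (e.coe_fst hp) rfl
  have hσp : σ (proj p) = p := by
    rw [hσ]
    simp only
    rw [← hep]
    exact e.toOpenPartialHomeomorph.left_inv hp
  have hγp : γ p = 1 := inv_mul_cancel _
  have hesrc : e.source ∈ 𝓝 p := e.open_source.mem_nhds hp
  have htgt : (proj p, a) ∈ e.target := e.mem_target.mpr hx
  have hγd : MDifferentiableAt IP IG γ p := by
    have h1 : ContMDiffAt IP IG ∞ (fun q => (e q).2) p := (he1.contMDiffAt hesrc).snd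
    exact ((contMDiff_mul_left (I := IG) (n := ∞) (a := a⁻¹)).contMDiffAt.comp p
      h1).mdifferentiableAt (by simp)
  have hσd : MDifferentiableAt IM IP σ (proj p) := by
    have h1 : ContMDiffAt IM (IM.prod IG) ∞ (fun x : M => (x, a)) (proj p) :=
      contMDiffAt_id.prodMk contMDiffAt_const
    exact ((he2.contMDiffAt (e.open_target.mem_nhds htgt)).comp (proj p) h1).mdifferentiableAt
      (by simp)
  have hpd : MDifferentiableAt IP IM proj p := hproj.contMDiff_proj.mdifferentiableAt (by simp)
  have hact := hproj.contMDiff_action.mdifferentiableAt (x := (p, (1 : G))) (by simp)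
  have hψ : (fun x : P × G => MulOpposite.op x.2 • x.1) ∘ (fun q => ((σ ∘ proj) q, γ q)) =ᶠ[𝓝 p]
      id := by
    filter_upwards [hesrc] with q hq
    have hqb : proj q ∈ e.baseSet := e.mem_source.mp hq
    have hqt : (proj q, a) ∈ e.target := e.mem_target.mpr hqb
    have hσq : σ (proj q) ∈ e.source := e.toOpenPartialHomeomorph.map_target hqt
    have hσe : e (σ (proj q)) = (proj q, a) := e.toOpenPartialHomeomorph.right_inv hqt
    have hσπ : proj (σ (proj q)) = proj q := e.proj_symm_apply' hqb
    have hs : MulOpposite.op (γ q) • σ (proj q) ∈ e.source := by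
      rw [e.mem_source, hproj.proj_action, hσπ]
      exact hqb
    refine e.injOn hs hq (show e (MulOpposite.op (γ q) • σ (proj q)) = e q from Prod.ext ?_ ?_)
    · rw [e.coe_fst hs, e.coe_fst hq, hproj.proj_action, hσπ]
    · rw [he _ hσq, hσe]
      exact mul_inv_cancel_left _ _
  have hσπd : MDifferentiableAt IP IP (σ ∘ proj) p := hσd.comp p hpd
  have hmain := mfderiv_comp_apply_of_eq p hact (hσπd.prodMk hγd)
    (Prod.ext hσp hγp) u
  have h0 : mfderiv IP IP (σ ∘ proj) p u = 0 := by
    rw [mfderiv_comp_apply p hσd hpd, hu, map_zero]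
  rw [hσπd.mfderiv_prod hγd] at hmain
  have hsum := hmain.trans (mfderiv_prod_eq_add_apply hact)
  rw [hψ.mfderiv_eq, mfderiv_id] at hsum
  have h1 : ∀ L : EP →L[ℝ] EP, L (mfderiv IP IP (σ ∘ proj) p u) = 0 := fun L => by
    rw [h0]; exact map_zero L
  -- The summands of `hsum` live in tangent spaces at points that are equal only propositionally,
  -- so the cancellation takes place in the model space.
  have hadd : ∀ x y z : EP, x = y + z → y = 0 → z = x := fun x y z h hy => by
    rw [h, hy, zero_add]
  exact ⟨mfderiv IP IG γ p u, hadd _ _ _ hsum (h1 _)⟩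

/-- An automorphism of the bundle covers a smooth map of the base. -/
theorem IsBundleAutomorphism.exists_baseMap
    (hproj : IsPrincipalBundle IM IG IP (G := G) proj) {F : P ≃ₘ^∞⟮IP, IP⟯ P}
    (hF : IsBundleAutomorphism G F) :
    ∃ f : M → M, ContMDiff IM IM ∞ f ∧ f ∘ proj = proj ∘ F := by
  have hfib : ∀ p q, proj p = proj q → proj (F p) = proj (F q) := by
    intro p q hpq
    obtain ⟨g, rfl⟩ := hproj.exists_smul_eq hpq
    rw [hF, hproj.proj_action]
  refine ⟨fun x => proj (F (Function.surjInv hproj.surjective x)), fun x => ?_, ?_⟩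
  · obtain ⟨e, hx, -, he, -⟩ := hproj.exists_trivialization x
    have hσ : ContMDiffAt IM IP ∞ (fun y : M => e.toOpenPartialHomeomorph.symm (y, 1)) x :=
      (he.contMDiffAt (e.open_target.mem_nhds (e.mem_target.mpr hx))).comp x
        (contMDiffAt_id.prodMk contMDiffAt_const)
    refine ((hproj.contMDiff_proj.comp F.contMDiff).contMDiffAt.comp x hσ).congr_of_eventuallyEq ?_
    filter_upwards [e.open_baseSet.mem_nhds hx] with y hy
    refine hfib _ _ ?_
    exact (Function.surjInv_eq hproj.surjective y).trans (e.proj_symm_apply' hy).symm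
  · ext p
    exact hfib _ _ (Function.surjInv_eq _ _)

theorem IsBundleAutomorphism.symm {K : Type*} [Group K] [MulAction Kᵐᵒᵖ P]
    {F : P ≃ₘ^∞⟮IP, IP⟯ P} (hF : IsBundleAutomorphism K F) :
    IsBundleAutomorphism K F.symm := fun p g => by
  refine F.injective (show F _ = F _ from ?_)
  rw [hF, F.apply_symm_apply, F.apply_symm_apply]

/-- An automorphism of the bundle covers a smooth map of the base with invertible differentials. -/
theorem IsBundleAutomorphism.exists_baseDiffeo
    (hproj : IsPrincipalBundle IM IG IP (G := G) proj) {F : P ≃ₘ^∞⟮IP, IP⟯ P}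
    (hF : IsBundleAutomorphism G F) :
    ∃ f : M → M, ContMDiff IM IM ∞ f ∧ (∀ x, (mfderiv IM IM f x).IsInvertible) ∧
      f ∘ proj = proj ∘ F := by
  obtain ⟨f, hf, hfp⟩ := hF.exists_baseMap hproj
  obtain ⟨f', hf', hfp'⟩ := hF.symm.exists_baseMap hproj
  refine ⟨f, hf, isInvertible_mfderiv_of_inverse (g := f') (hf.mdifferentiable (by simp))
    (hf'.mdifferentiable (by simp)) ?_ ?_, hfp⟩
  · refine hproj.surjective.forall.mpr fun p => ?_
    have h1 := congrFun hfp p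
    have h2 := congrFun hfp' (F p)
    simp only [Function.comp_apply] at h1 h2
    rw [h1, h2, F.symm_apply_apply]
  · refine hproj.surjective.forall.mpr fun p => ?_
    have h1 := congrFun hfp (F.symm p)
    have h2 := congrFun hfp' p
    simp only [Function.comp_apply] at h1 h2
    rw [h2, h1, F.apply_symm_apply]

/-- Fundamental vector fields are invariant under automorphisms of the bundle. -/
theorem IsBundleAutomorphism.mfderiv_fundamentalVector
    (hproj : IsPrincipalBundle IM IG IP (G := G) proj) {F : P ≃ₘ^∞⟮IP, IP⟯ P}
    (hF : IsBundleAutomorphism G F) (p : P) (z : GroupLieAlgebra IG G) :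
    mfderiv IP IP F p (fundamentalVector IG IP p z) = fundamentalVector IG IP (F p) z := by
  -- The orbit map sends `1` to `op 1 • p`, which equals `p` only propositionally.
  have h := mfderiv_comp_apply_of_eq (1 : G) (F.contMDiff.mdifferentiableAt (x := p) (by simp))
    ((hproj.contMDiff_orbit p).mdifferentiableAt (by simp)) (one_smul Gᵐᵒᵖ p) z
  have h2 : F ∘ (fun g : G => MulOpposite.op g • p) = fun g : G => MulOpposite.op g • F p :=
    funext fun g => hF p g
  rw [h2] at h
  exact h.symm

theorem IsBundleAutomorphism.mfderiv_smul
    (hproj : IsPrincipalBundle IM IG IP (G := G) proj) {F : P ≃ₘ^∞⟮IP, IP⟯ P}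
    (hF : IsBundleAutomorphism G F) (p : P) (g : G) (u : TangentSpace IP p) :
    mfderiv IP IP F (MulOpposite.op g • p)
        (mfderiv IP IP (fun q : P => MulOpposite.op g • q) p u) =
      mfderiv IP IP (fun q : P => MulOpposite.op g • q) (F p) (mfderiv IP IP F p u) := by
  have hFd := F.contMDiff.mdifferentiable (by simp)
  have hgd := (hproj.contMDiff_smul g).mdifferentiable (by simp)
  rw [← mfderiv_comp_apply p (hFd _) (hgd p), ← mfderiv_comp_apply p (hgd _) (hFd p)]
  have h2 : F ∘ (fun q : P => MulOpposite.op g • q) = (fun q : P => MulOpposite.op g • q) ∘ F :=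
    funext fun q => hF q g
  rw [h2]

variable (IM) in
/-- Orthogonal projections with respect to a positive definite tensor are unique. -/
theorem verticalProj_eq_of_pos {h : TwoTensor IP P} {p : P}
    (hpos : ∀ u : TangentSpace IP p, u ≠ 0 → 0 < h p u u) {u w : TangentSpace IP p}
    (hw : w ∈ verticalSpace IM IP proj p)
    (horth : ∀ v ∈ verticalSpace IM IP proj p, h p (u - w) v = 0) :
    verticalProj IM proj h p u = w := by
  have H : ∃ w ∈ verticalSpace IM IP proj p, ∀ v ∈ verticalSpace IM IP proj p, h p (u - w) v = 0 :=
    ⟨w, hw, horth⟩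
  rw [verticalProj, dif_pos H]
  obtain ⟨h1, h2⟩ := H.choose_spec
  by_contra hne
  have hm := Submodule.sub_mem _ h1 hw
  have e : H.choose - w = (u - w) - (u - H.choose) := by abel
  have : h p (H.choose - w) (H.choose - w) = 0 := by
    have e2 := LinearMap.BilinForm.sub_left (B₁ := h p) (u - w) (u - H.choose) (H.choose - w)
    rw [← e, horth _ hm, h2 _ hm, sub_zero] at e2
    exact e2
  exact (hpos _ (sub_ne_zero.mpr hne)).ne' this

/-- An automorphism of the bundle preserves verticality of vectors. -/
theorem IsBundleAutomorphism.mem_verticalSpace_iff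
    (hproj : IsPrincipalBundle IM IG IP (G := G) proj) {F : P ≃ₘ^∞⟮IP, IP⟯ P}
    (hF : IsBundleAutomorphism G F) {p : P} {u : TangentSpace IP p} :
    mfderiv IP IP F p u ∈ verticalSpace IM IP proj (F p) ↔ u ∈ verticalSpace IM IP proj p := by
  obtain ⟨f, hf, hf', hfp⟩ := hF.exists_baseDiffeo hproj
  have hproj' := hproj.contMDiff_proj.mdifferentiable (n := ∞) (by simp)
  have h1 := mfderiv_comp_apply p (hf.mdifferentiable (by simp) (proj p)) (hproj' p) u
  have h2 := mfderiv_comp_apply p (hproj' (F p)) (F.contMDiff.mdifferentiable (by simp) p) u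
  rw [hfp] at h1
  have h3 : mfderiv IP IM proj (F p) (mfderiv IP IP F p u) =
      mfderiv IM IM f (proj p) (mfderiv IP IM proj p u) := h2.symm.trans h1
  constructor
  · intro h
    exact (hf' (proj p)).injective ((h3.symm.trans h).trans (map_zero _).symm)
  · intro h
    have h0 : mfderiv IP IM proj p u = 0 := h
    exact h3.trans ((congrArg (mfderiv IM IM f (proj p)) h0).trans (map_zero _))

/-- The orthogonal projection onto the vertical space is natural under automorphisms. -/
theorem mfderiv_verticalProj_pullback
    (hproj : IsPrincipalBundle IM IG IP (G := G) proj) {F : P ≃ₘ^∞⟮IP, IP⟯ P}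
    (hF : IsBundleAutomorphism G F) {h : TwoTensor IP P} {p : P}
    (hpos : ∀ u : TangentSpace IP (F p), u ≠ 0 → 0 < h (F p) u u) (u : TangentSpace IP p) :
    mfderiv IP IP F p (verticalProj IM proj (h.pullback IP F) p u) =
      verticalProj IM proj h (F p) (mfderiv IP IP F p u) := by
  by_cases H : ∃ w ∈ verticalSpace IM IP proj p,
      ∀ v ∈ verticalSpace IM IP proj p, h.pullback IP F p (u - w) v = 0
  · rw [verticalProj, dif_pos H]
    obtain ⟨h1, h2⟩ := H.choose_spec
    refine (verticalProj_eq_of_pos IM hpos ((hF.mem_verticalSpace_iff hproj).mpr h1)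
      fun v' hv' => ?_).symm
    obtain ⟨v, rfl⟩ := (F.isInvertible_mfderiv p).surjective v'
    have h3 := h2 v ((hF.mem_verticalSpace_iff hproj).mp hv')
    rwa [TwoTensor.pullback_apply, map_sub] at h3
  -- Without an orthogonal projection both sides are the default value `0`.
  · have H' : ¬ ∃ w ∈ verticalSpace IM IP proj (F p), ∀ v ∈ verticalSpace IM IP proj (F p),
        h (F p) (mfderiv IP IP F p u - w) v = 0 := by
      rintro ⟨w', hw', ho⟩
      obtain ⟨w, rfl⟩ := (F.isInvertible_mfderiv p).surjective w'
      refine H ⟨w, (hF.mem_verticalSpace_iff hproj).mp hw', fun v hv => ?_⟩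
      rw [TwoTensor.pullback_apply, map_sub]
      exact ho _ ((hF.mem_verticalSpace_iff hproj).mpr hv)
    rw [verticalProj, dif_neg H, verticalProj, dif_neg H', map_zero]

/-- The pullback of a connection form under an automorphism of the bundle. -/
def ConnectionForm.pullback [IsManifold IP ∞ P] (A : ConnectionForm IG IP G P)
    (hproj : IsPrincipalBundle IM IG IP (G := G) proj) {F : P ≃ₘ^∞⟮IP, IP⟯ P}
    (hF : IsBundleAutomorphism G F) : ConnectionForm IG IP G P where
  form p := (A.form (F p)).comp (mfderiv IP IP F p)
  contMDiff_form := A.contMDiff_form.comp (F.contMDiff.contMDiff_tangentMap (m := ∞) (by simp))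
  form_fundamentalVector p z := by
    rw [ContinuousLinearMap.comp_apply, hF.mfderiv_fundamentalVector hproj,
      A.form_fundamentalVector]
  form_action p g u := by
    have h := A.form_action (F p) g (mfderiv IP IP F p u)
    rw [← hF.mfderiv_smul hproj, ← hF p g] at h
    exact h

end PrincipalBundleGeometry

/-! ### Bundle metrics and the flow -/

section BundleMetrics

open Filter Topology

variable {EM : Type*} [NormedAddCommGroup EM] [NormedSpace ℝ EM]
  {HM : Type*} [TopologicalSpace HM] {IM : ModelWithCorners ℝ EM HM}
  {EG : Type*} [NormedAddCommGroup EG] [NormedSpace ℝ EG]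
  {HG : Type*} [TopologicalSpace HG] {IG : ModelWithCorners ℝ EG HG}
  {EP : Type*} [NormedAddCommGroup EP] [NormedSpace ℝ EP]
  {HP : Type*} [TopologicalSpace HP] {IP : ModelWithCorners ℝ EP HP}
  {M : Type*} [TopologicalSpace M] [ChartedSpace HM M] [IsManifold IM ∞ M]
  {G : Type*} [TopologicalSpace G] [ChartedSpace HG G] [Group G]
  {P : Type*} [TopologicalSpace P] [ChartedSpace HP P] [IsManifold IP ∞ P] [MulAction Gᵐᵒᵖ P]
  {proj : P → M} {k : AdInvariantMetric IG G}

theorem IsBundleMetric.symm {h : TwoTensor IP P} (hh : IsBundleMetric IM k proj h) (p : P)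
    (u v : TangentSpace IP p) : h p u v = h p v u := by
  obtain ⟨g, A, hA⟩ := hh
  rw [hA, hA, g.symm, k.symm]

/-- Bundle metrics are positive definite: a null vector is vertical, hence fundamental, and the
connection form sends it to zero. -/
theorem IsBundleMetric.pos [LieGroup IG ∞ G]
    (hproj : IsPrincipalBundle IM IG IP (G := G) proj) {h : TwoTensor IP P}
    (hh : IsBundleMetric IM k proj h) (p : P) (u : TangentSpace IP p) (hu : u ≠ 0) :
    0 < h p u u := by
  obtain ⟨g, A, hA⟩ := hh
  rw [hA]
  have hk : 0 ≤ k.inner (A.form p u) (A.form p u) := by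
    by_cases h0 : A.form p u = 0
    · simp [h0]
    · exact (k.pos _ h0).le
  by_cases hv : mfderiv IP IM proj p u = 0
  · obtain ⟨z, rfl⟩ := hproj.exists_fundamentalVector_eq hv
    rw [hv, A.form_fundamentalVector, map_zero, zero_add]
    refine k.pos z fun hz => hu ?_
    rw [hz, map_zero]
  · exact add_pos_of_pos_of_nonneg (g.pos _ _ hv) hk

/-- Bundle metrics have smooth coordinate expressions. -/
theorem IsBundleMetric.contDiffAt_inChart [FiniteDimensional ℝ EG] [FiniteDimensional ℝ EP]
    [IP.Boundaryless] (hproj : IsPrincipalBundle IM IG IP (G := G) proj) {h : TwoTensor IP P}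
    (hh : IsBundleMetric IM k proj h) (p : P) {y : EP} (hy : y ∈ (extChartAt IP p).target) :
    ContDiffAt ℝ ∞ (h.inChart p) y := by
  obtain ⟨g, A, hA⟩ := hh
  refine TwoTensor.contDiffAt_inChart h (fun b v w y hv hw => ?_) p hy
  have hT := hproj.contMDiff_proj.contMDiff_tangentMap (m := ∞) (by simp)
  have hg := g.contMDiffAt_inner (b := proj ∘ b)
    (v := fun z => mfderiv IP IM proj (b z) (v z)) (w := fun z => mfderiv IP IM proj (b z) (w z))
    (hT.contMDiffAt.comp y hv) (hT.contMDiffAt.comp y hw)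
  have hAv := A.contMDiff_form.contMDiffAt.comp y hv
  have hAw := A.contMDiff_form.contMDiffAt.comp y hw
  let k' : EG →ₗ[ℝ] EG →ₗ[ℝ] ℝ := k.inner
  have hk : ContDiff ℝ ∞ (fun x : EG × EG => LinearMap.toContinuousBilinearMap k' x.1 x.2) :=
    (LinearMap.toContinuousBilinearMap k').isBoundedBilinearMap.contDiff
  have hkA := hk.comp_contMDiffAt (hAv.prodMk_space hAw)
  exact (hg.add hkA).congr_of_eventuallyEq (.of_forall fun z => hA _ _ _)

/-- The class of bundle metrics is invariant under automorphisms of the bundle: if `F` covers `f`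
then `F^* (π^* g + k A) = π^* (f^* g) + k (F^* A)`. -/
theorem IsBundleMetric.pullback [FiniteDimensional ℝ EM]
    (hproj : IsPrincipalBundle IM IG IP (G := G) proj) {h : TwoTensor IP P}
    (hh : IsBundleMetric IM k proj h) {F : P ≃ₘ^∞⟮IP, IP⟯ P} (hF : IsBundleAutomorphism G F) :
    IsBundleMetric IM k proj (h.pullback IP F) := by
  obtain ⟨g, A, hA⟩ := hh
  obtain ⟨f, hf, hf', hfp⟩ := hF.exists_baseDiffeo hproj
  refine ⟨g.pullback f hf hf', A.pullback hproj hF, fun p u v => ?_⟩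
  rw [TwoTensor.pullback_apply, hA]
  refine congrArg (· + _) ?_
  -- The two sides are `F^* π^* g` and `π^* f^* g`, the pullbacks under `π ∘ F = f ∘ π`.
  let gT : TwoTensor IM M := fun x => ContinuousLinearMap.coeLM ℝ ∘ₗ (g.inner x).toLinearMap
  have hproj' := hproj.contMDiff_proj.mdifferentiable (n := ∞) (by simp)
  have h1 := TwoTensor.pullback_comp (I := IP) gT (hf.mdifferentiable (by simp) (proj p))
    (hproj' p)
  have h2 := TwoTensor.pullback_comp (I := IP) gT (hproj' (F p))
    (F.contMDiff.mdifferentiable (by simp) p)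
  rw [hfp, h2] at h1
  exact congrArg (fun B : LinearMap.BilinForm ℝ (TangentSpace IP p) => B u v) h1

section Flow

variable [FiniteDimensional ℝ EG] [FiniteDimensional ℝ EP]
  [IP.Boundaryless] [LieGroup IG ∞ G]

theorem IsBundleMetric.ricci_pullback (hproj : IsPrincipalBundle IM IG IP (G := G) proj)
    {h : TwoTensor IP P} (hh : IsBundleMetric IM k proj h) (F : P ≃ₘ^∞⟮IP, IP⟯ P) (p : P)
    (u v : TangentSpace IP p) :
    ricci (h.pullback IP F) p u v = ricci h (F p) (mfderiv IP IP F p u) (mfderiv IP IP F p v) :=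
  _root_.ricci_pullback F.contMDiff.contMDiffAt (F.isInvertible_mfderiv p) hh.symm (hh.pos hproj)
    ((hh.contDiffAt_inChart hproj (F p) (mem_extChartAt_target (F p))).of_le
      (by norm_cast)) u v

theorem IsBundleMetric.ricciVertical_pullback
    (hproj : IsPrincipalBundle IM IG IP (G := G) proj)
    {h : TwoTensor IP P} (hh : IsBundleMetric IM k proj h) {F : P ≃ₘ^∞⟮IP, IP⟯ P}
    (hF : IsBundleAutomorphism G F) (p : P) (u v : TangentSpace IP p) :
    ricciVertical IM proj (h.pullback IP F) p u v =
      ricciVertical IM proj h (F p) (mfderiv IP IP F p u) (mfderiv IP IP F p v) := by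
  rw [ricciVertical, hh.ricci_pullback hproj,
    mfderiv_verticalProj_pullback hproj hF (hh.pos hproj _),
    mfderiv_verticalProj_pullback hproj hF (hh.pos hproj _), ricciVertical]

/-- Automorphisms of the bundle carry solutions of the flow to solutions: every term of the
evolution equation is natural. -/
theorem IsRicciYangMillsFlow.pullback [FiniteDimensional ℝ EM]
    (hproj : IsPrincipalBundle IM IG IP (G := G) proj)
    {J : Set ℝ} {h : ℝ → TwoTensor IP P} (hh : IsRicciYangMillsFlow IM k proj J h)
    {F : P ≃ₘ^∞⟮IP, IP⟯ P} (hF : IsBundleAutomorphism G F) :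
    IsRicciYangMillsFlow IM k proj J (fun t => (h t).pullback IP F) where
  isBundleMetric t ht := (hh.isBundleMetric t ht).pullback hproj hF
  contMDiffOn := by
    have hT := F.contMDiff.contMDiff_tangentMap (m := ∞) (by simp)
    exact hh.contMDiffOn.comp
      (contMDiff_fst.prodMk (hT.comp contMDiff_snd)).contMDiffOn fun x hx => ⟨hx.1, Set.mem_univ _⟩
  evolution t ht p u v := by
    have hb := hh.isBundleMetric t ht
    rw [hb.ricci_pullback hproj, hb.ricciVertical_pullback hproj hF]
    exact hh.evolution t ht (F p) _ _

end Flow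

end BundleMetrics

end

theorem mainTheorem4
    {EM : Type*} [NormedAddCommGroup EM] [NormedSpace ℝ EM] [FiniteDimensional ℝ EM]
    {HM : Type*} [TopologicalSpace HM] (IM : ModelWithCorners ℝ EM HM) [IM.Boundaryless]
    {EG : Type*} [NormedAddCommGroup EG] [NormedSpace ℝ EG] [FiniteDimensional ℝ EG]
    {HG : Type*} [TopologicalSpace HG] (IG : ModelWithCorners ℝ EG HG) [IG.Boundaryless]
    {EP : Type*} [NormedAddCommGroup EP] [NormedSpace ℝ EP] [FiniteDimensional ℝ EP]
    {HP : Type*} [TopologicalSpace HP] (IP : ModelWithCorners ℝ EP HP) [IP.Boundaryless]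
    {M : Type*} [TopologicalSpace M] [ChartedSpace HM M] [IsManifold IM ∞ M]
    {G : Type*} [TopologicalSpace G] [ChartedSpace HG G] [Group G] [LieGroup IG ∞ G]
    {P : Type*} [TopologicalSpace P] [ChartedSpace HP P] [IsManifold IP ∞ P]
    [MulAction Gᵐᵒᵖ P]
    (proj : P → M) (hproj : IsPrincipalBundle IM IG IP (G := G) proj)
    (k : AdInvariantMetric IG G)
    (F : P ≃ₘ^∞⟮IP, IP⟯ P) (hF : IsBundleAutomorphism G F) :
    (∀ (J : Set ℝ), J.OrdConnected → ∀ h : ℝ → TwoTensor IP P,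
      IsRicciYangMillsFlow IM k proj J (fun t => (h t).pullback IP F) ↔
        IsRicciYangMillsFlow IM k proj J h) ∧
    (∀ h : TwoTensor IP P, IsBundleMetric IM k proj h →
      IsBundleMetric IM k proj (h.pullback IP F) ∧
      ∀ (p : P) (u v : TangentSpace IP p),
        ricciVertical IM proj (h.pullback IP F) p u v =
          ricciVertical IM proj h (F p) (mfderiv IP IP F p u) (mfderiv IP IP F p v)) := by
  refine ⟨fun J _ h => ⟨fun hh => ?_, fun hh => hh.pullback hproj hF⟩, fun h hh =>
    ⟨hh.pullback hproj hF, hh.ricciVertical_pullback hproj hF⟩⟩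
  have h1 := hh.pullback hproj hF.symm
  simpa only [TwoTensor.pullback_symm_pullback] using h1
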